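/- Let $n\ge 2$, let $\mathbb F$ be a field, and let $L$ be an $n$-Lie algebra over $\mathbb F$ (not necessarily finite-dimensional), i.e. an $\mathbb F$-vector space with an alternating $n$-linear bracket satisfying \[[[x_1,\dots,x_n],y_2,\dots,y_n]=\sum_{i=1}^n[x_1,\dots,[x_i,y_2,\dots,y_n],\dots,x_n].\] Let $0=Z_0(L)\subseteq Z_1(L)\subseteq Z_2(L)\subseteq\cdots$ be the upper central series, where $Z_1(L)=Z(L)$ is the centre and $Z_{i+1}(L)/Z_i(L)=Z(L/Z_i(L))$, and let $\gamma_1(L)=L$, $\gamma_{i+1}(L)=[\gamma_i(L),L,\dots,L]$ be the lower central series. Let $l_d^n(3)=\binom dn\binom d{n-1}$ be the number of basic commutators of weight $3$ on $d$ ordered generators $x_1<\dots<x_d$, that is, of formal brackets $[[x_{i_1},\dots,x_{i_n}],x_{j_2},\dots,x_{j_n}]$ in which $x_{i_1},\dots,x_{i_n}$ are strictly ordered and $x_{j_2},\dots,x_{j_n}$ are strictly ordered. Let $F$ be the free $n$-Lie algebra over $\mathbb F$ on $d$ generators. Theorem. If $\dim L/Z_2(L)=d$ is finite, then \[\dim\gamma_3(L)\le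 l_d^n(3),\] and, more precisely, \[\dim\gamma_3(L)\ \le\ \dim\gamma_3(F)/\gamma_4(F)\ \le\ l_d^n(3).\] -/

import Mathlib

universe u v

/-- An `n`-Lie (Filippov) algebra over a field `𝔽`: a vector space `L` with an alternating
`n`-linear bracket satisfying
`[[x₁,…,xₙ],y₂,…,yₙ] = ∑ᵢ [x₁,…,[xᵢ,y₂,…,yₙ],…,xₙ]`.
Here `Function.update y 0 z` is the tuple `(z, y₂, …, yₙ)`; the first entry of `y` is ignored. -/
class NLieAlgebra (n : ℕ) [NeZero n] (𝔽 : Type u) (L : Type v) [Field 𝔽] [AddCommGroup L]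
    [Module 𝔽 L] where
  bracket : L [⋀^Fin n]→ₗ[𝔽] L
  filippov : ∀ x y : Fin n → L,
    bracket (Function.update y 0 (bracket x)) =
      ∑ i, bracket (Function.update x i (bracket (Function.update y 0 (x i))))

namespace NLieAlgebra

section Series

variable (n : ℕ) [NeZero n] (𝔽 : Type u) (L : Type v) [Field 𝔽] [AddCommGroup L] [Module 𝔽 L]
  [NLieAlgebra n 𝔽 L]

/-- The upper central series `Z₀ = 0`, `Zᵢ₊₁ = {z | [z, L, …, L] ⊆ Zᵢ}`, that is,
`Zᵢ₊₁ / Zᵢ` is the centre of `L / Zᵢ`. In particular `Z₁ = Z(L)` is the centre. -/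
def upperCentral : ℕ → Submodule 𝔽 L
  | 0 => ⊥
  | i + 1 =>
    { carrier := {z | ∀ y : Fin n → L, bracket (n := n) (𝔽 := 𝔽) (Function.update y 0 z) ∈
        upperCentral i}
      zero_mem' := fun y => by
        rw [AlternatingMap.map_update_zero]
        exact Submodule.zero_mem _
      add_mem' := fun {a b} ha hb y => by
        rw [AlternatingMap.map_update_add]
        exact Submodule.add_mem _ (ha y) (hb y)
      smul_mem' := fun c a ha y => by
        rw [AlternatingMap.map_update_smul]
        exact Submodule.smul_mem _ c (ha y) }

/-- The lower central series `γ₁(L) = L`, `γᵢ₊₁(L) = [γᵢ(L), L, …, L]` (with `γ₀(L) = L` as a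
dummy value). The span below is an ideal, hence it is also the subalgebra generated by the
brackets `[a, y₂, …, yₙ]` with `a ∈ γᵢ(L)`. -/
def lowerCentral : ℕ → Submodule 𝔽 L
  | 0 => ⊤
  | 1 => ⊤
  | i + 2 => Submodule.span 𝔽
      {z | ∃ a ∈ lowerCentral (i + 1), ∃ y : Fin n → L,
        z = bracket (n := n) (𝔽 := 𝔽) (Function.update y 0 a)}

end Series

/-! The free `n`-Lie algebra on a set `X`: formal expressions in the elements of `X`, modulo the
congruence generated by the axioms of an `n`-Lie algebra. -/

/-- Formal expressions. -/
inductive FreePre (n : ℕ) (𝔽 : Type u) (X : Type v) : Type (max u v)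
  | of : X → FreePre n 𝔽 X
  | zero : FreePre n 𝔽 X
  | add : FreePre n 𝔽 X → FreePre n 𝔽 X → FreePre n 𝔽 X
  | smul : 𝔽 → FreePre n 𝔽 X → FreePre n 𝔽 X
  | bracket : (Fin n → FreePre n 𝔽 X) → FreePre n 𝔽 X

namespace FreePre

/-- The sum of a finite sequence of formal expressions. -/
def sum {n : ℕ} {𝔽 : Type u} {X : Type v} : {k : ℕ} → (Fin k → FreePre n 𝔽 X) → FreePre n 𝔽 X
  | 0, _ => zero
  | _ + 1, f => add (f 0) (sum fun i => f i.succ)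

/-- The congruence generated by the axioms of an `n`-Lie algebra. -/
inductive Rel (n : ℕ) [NeZero n] (𝔽 : Type u) [Field 𝔽] (X : Type v) :
    FreePre n 𝔽 X → FreePre n 𝔽 X → Prop
  -- congruence
  | refl (a) : Rel n 𝔽 X a a
  | symm {a b} : Rel n 𝔽 X a b → Rel n 𝔽 X b a
  | trans {a b c} : Rel n 𝔽 X a b → Rel n 𝔽 X b c → Rel n 𝔽 X a c
  | add_congr {a a' b b'} : Rel n 𝔽 X a a' → Rel n 𝔽 X b b' → Rel n 𝔽 X (add a b) (add a' b')
  | smul_congr (r : 𝔽) {a a'} : Rel n 𝔽 X a a' → Rel n 𝔽 X (smul r a) (smul r a')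
  | bracket_congr {x y : Fin n → FreePre n 𝔽 X} :
      (∀ i, Rel n 𝔽 X (x i) (y i)) → Rel n 𝔽 X (bracket x) (bracket y)
  -- vector space axioms
  | add_assoc (a b c) : Rel n 𝔽 X (add (add a b) c) (add a (add b c))
  | add_comm (a b) : Rel n 𝔽 X (add a b) (add b a)
  | zero_add (a) : Rel n 𝔽 X (add zero a) a
  | smul_add (r : 𝔽) (a b) : Rel n 𝔽 X (smul r (add a b)) (add (smul r a) (smul r b))
  | add_smul (r s : 𝔽) (a) : Rel n 𝔽 X (smul (r + s) a) (add (smul r a) (smul s a))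
  | mul_smul (r s : 𝔽) (a) : Rel n 𝔽 X (smul (r * s) a) (smul r (smul s a))
  | one_smul (a) : Rel n 𝔽 X (smul 1 a) a
  | zero_smul (a) : Rel n 𝔽 X (smul 0 a) zero
  -- the bracket is multilinear and alternating, and satisfies the Filippov identity
  | bracket_add (x : Fin n → FreePre n 𝔽 X) (i : Fin n) (a b) :
      Rel n 𝔽 X (bracket (Function.update x i (add a b)))
        (add (bracket (Function.update x i a)) (bracket (Function.update x i b)))
  | bracket_smul (x : Fin n → FreePre n 𝔽 X) (i : Fin n) (r : 𝔽) (a) :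
      Rel n 𝔽 X (bracket (Function.update x i (smul r a)))
        (smul r (bracket (Function.update x i a)))
  | bracket_alt (x : Fin n → FreePre n 𝔽 X) (i j : Fin n) (hij : i ≠ j) (h : x i = x j) :
      Rel n 𝔽 X (bracket x) zero
  | filippov (x y : Fin n → FreePre n 𝔽 X) :
      Rel n 𝔽 X (bracket (Function.update y 0 (bracket x)))
        (sum fun i => bracket (Function.update x i (bracket (Function.update y 0 (x i)))))

/-- The congruence as a setoid. -/
def relSetoid (n : ℕ) [NeZero n] (𝔽 : Type u) [Field 𝔽] (X : Type v) : Setoid (FreePre n 𝔽 X) :=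
  ⟨Rel n 𝔽 X, ⟨Rel.refl, Rel.symm, Rel.trans⟩⟩

end FreePre

/-- The free `n`-Lie algebra over `𝔽` on the set `X`. -/
def Free (n : ℕ) [NeZero n] (𝔽 : Type u) [Field 𝔽] (X : Type v) : Type (max u v) :=
  Quotient (FreePre.relSetoid n 𝔽 X)

namespace Free

variable {n : ℕ} [NeZero n] {𝔽 : Type u} [Field 𝔽] {X : Type v}

/-- The class of a formal expression. -/
def mk (a : FreePre n 𝔽 X) : Free n 𝔽 X := Quotient.mk (FreePre.relSetoid n 𝔽 X) a

theorem mk_eq {a b : FreePre n 𝔽 X} (h : FreePre.Rel n 𝔽 X a b) : mk a = mk b :=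
  Quotient.sound (s := FreePre.relSetoid n 𝔽 X) h

/-- The free generators. -/
def of (n : ℕ) [NeZero n] (𝔽 : Type u) [Field 𝔽] {X : Type v} (x : X) : Free n 𝔽 X :=
  mk (FreePre.of x)

theorem mk_surjective : Function.Surjective (mk : FreePre n 𝔽 X → Free n 𝔽 X) :=
  Quotient.exists_rep

instance : Zero (Free n 𝔽 X) := ⟨mk FreePre.zero⟩

instance : Add (Free n 𝔽 X) :=
  ⟨Quotient.map₂ FreePre.add fun _ _ h _ _ h' => FreePre.Rel.add_congr h h'⟩

instance : SMul 𝔽 (Free n 𝔽 X) :=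
  ⟨fun r => Quotient.map (FreePre.smul r) fun _ _ h => FreePre.Rel.smul_congr r h⟩

instance : Neg (Free n 𝔽 X) := ⟨fun a => (-1 : 𝔽) • a⟩

theorem mk_zero : mk FreePre.zero = (0 : Free n 𝔽 X) := rfl

theorem mk_add (a b : FreePre n 𝔽 X) : mk (FreePre.add a b) = mk a + mk b := rfl

theorem mk_smul (r : 𝔽) (a : FreePre n 𝔽 X) : mk (FreePre.smul r a) = r • mk a := rfl

protected theorem zero_add' (a : Free n 𝔽 X) : 0 + a = a := by
  obtain ⟨a, rfl⟩ := mk_surjective a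
  exact mk_eq (FreePre.Rel.zero_add a)

protected theorem add_comm' (a b : Free n 𝔽 X) : a + b = b + a := by
  obtain ⟨a, rfl⟩ := mk_surjective a
  obtain ⟨b, rfl⟩ := mk_surjective b
  exact mk_eq (FreePre.Rel.add_comm a b)

protected theorem add_smul' (r s : 𝔽) (a : Free n 𝔽 X) : (r + s) • a = r • a + s • a := by
  obtain ⟨a, rfl⟩ := mk_surjective a
  exact mk_eq (FreePre.Rel.add_smul r s a)

protected theorem one_smul' (a : Free n 𝔽 X) : (1 : 𝔽) • a = a := by
  obtain ⟨a, rfl⟩ := mk_surjective a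
  exact mk_eq (FreePre.Rel.one_smul a)

protected theorem zero_smul' (a : Free n 𝔽 X) : (0 : 𝔽) • a = 0 := by
  obtain ⟨a, rfl⟩ := mk_surjective a
  exact mk_eq (FreePre.Rel.zero_smul a)

instance : AddCommGroup (Free n 𝔽 X) where
  add_assoc a b c := by
    obtain ⟨a, rfl⟩ := mk_surjective a
    obtain ⟨b, rfl⟩ := mk_surjective b
    obtain ⟨c, rfl⟩ := mk_surjective c
    exact mk_eq (FreePre.Rel.add_assoc a b c)
  zero_add := Free.zero_add'
  add_zero a := by rw [Free.add_comm', Free.zero_add']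
  add_comm := Free.add_comm'
  neg_add_cancel a := by
    change (-1 : 𝔽) • a + a = 0
    conv_lhs => rw [← Free.one_smul' a]
    rw [Free.one_smul' a]
    nth_rewrite 2 [← Free.one_smul' a]
    rw [← Free.add_smul', neg_add_cancel, Free.zero_smul']
  nsmul := nsmulRec
  zsmul := zsmulRec

instance : Module 𝔽 (Free n 𝔽 X) where
  one_smul := Free.one_smul'
  mul_smul r s a := by
    obtain ⟨a, rfl⟩ := mk_surjective a
    exact mk_eq (FreePre.Rel.mul_smul r s a)
  smul_zero r := by
    have h : r • (0 : Free n 𝔽 X) + r • (0 : Free n 𝔽 X) = r • (0 : Free n 𝔽 X) := by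
      have h1 : r • ((0 : Free n 𝔽 X) + 0) = r • (0 : Free n 𝔽 X) + r • (0 : Free n 𝔽 X) :=
        mk_eq (FreePre.Rel.smul_add r FreePre.zero FreePre.zero)
      rw [← h1, add_zero]
    simpa using h
  smul_add r a b := by
    obtain ⟨a, rfl⟩ := mk_surjective a
    obtain ⟨b, rfl⟩ := mk_surjective b
    exact mk_eq (FreePre.Rel.smul_add r a b)
  add_smul := Free.add_smul'
  zero_smul := Free.zero_smul'

/-- The bracket of classes, computed on representatives. -/
noncomputable def bracketFun (x : Fin n → Free n 𝔽 X) : Free n 𝔽 X :=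
  mk (FreePre.bracket fun i => Quotient.out (x i))

theorem mk_bracket (x : Fin n → FreePre n 𝔽 X) :
    mk (FreePre.bracket x) = bracketFun fun i => mk (x i) :=
  mk_eq (FreePre.Rel.bracket_congr fun i =>
    FreePre.Rel.symm (Quotient.mk_out (s := FreePre.relSetoid n 𝔽 X) (x i)))

theorem exists_rep (x : Fin n → Free n 𝔽 X) :
    ∃ a : Fin n → FreePre n 𝔽 X, x = fun i => mk (a i) :=
  ⟨fun i => Quotient.out (x i), funext fun i => (Quotient.out_eq (x i)).symm⟩

theorem update_mk (a : Fin n → FreePre n 𝔽 X) (i : Fin n) (b : FreePre n 𝔽 X) :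
    Function.update (fun j => mk (a j)) i (mk b) = fun j => mk (Function.update a i b j) := by
  funext j
  by_cases h : j = i
  · subst h; simp
  · simp [h]

theorem bracketFun_update_mk (a : Fin n → FreePre n 𝔽 X) (i : Fin n) (b : FreePre n 𝔽 X) :
    bracketFun (Function.update (fun j => mk (a j)) i (mk b)) =
      mk (FreePre.bracket (Function.update a i b)) := by
  rw [update_mk, ← mk_bracket]

theorem mk_sum {k : ℕ} (f : Fin k → FreePre n 𝔽 X) : mk (FreePre.sum f) = ∑ i, mk (f i) := by
  induction k with
  | zero => rw [Fin.sum_univ_zero]; rfl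
  | succ k ih => rw [Fin.sum_univ_succ, ← ih]; rfl

/-- The bracket of the free `n`-Lie algebra as an alternating map. -/
noncomputable def bracketMap (n : ℕ) [NeZero n] (𝔽 : Type u) [Field 𝔽] (X : Type v) :
    Free n 𝔽 X [⋀^Fin n]→ₗ[𝔽] Free n 𝔽 X where
  toFun := bracketFun
  map_update_add' := by
    intro inst x i a b
    rw [Subsingleton.elim inst (instDecidableEqFin n)]
    obtain ⟨x, rfl⟩ := exists_rep x
    obtain ⟨a, rfl⟩ := mk_surjective a
    obtain ⟨b, rfl⟩ := mk_surjective b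
    rw [← mk_add, bracketFun_update_mk, bracketFun_update_mk, bracketFun_update_mk]
    exact mk_eq (FreePre.Rel.bracket_add x i a b)
  map_update_smul' := by
    intro inst x i r a
    rw [Subsingleton.elim inst (instDecidableEqFin n)]
    obtain ⟨x, rfl⟩ := exists_rep x
    obtain ⟨a, rfl⟩ := mk_surjective a
    rw [← mk_smul, bracketFun_update_mk, bracketFun_update_mk]
    exact mk_eq (FreePre.Rel.bracket_smul x i r a)
  map_eq_zero_of_eq' := by
    intro x i j h hij
    exact mk_eq (FreePre.Rel.bracket_alt _ i j hij (by rw [h]))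

noncomputable instance : NLieAlgebra n 𝔽 (Free n 𝔽 X) where
  bracket := bracketMap n 𝔽 X
  filippov x y := by
    obtain ⟨x, rfl⟩ := exists_rep x
    obtain ⟨y, rfl⟩ := exists_rep y
    change bracketFun (Function.update _ 0 (bracketFun _)) =
      ∑ i, bracketFun (Function.update _ i (bracketFun (Function.update _ 0 (mk (x i)))))
    simp only [← mk_bracket, bracketFun_update_mk]
    rw [← mk_sum]
    exact mk_eq (FreePre.Rel.filippov x y)

end Free

/-- A basic commutator of weight `3` on the ordered generators `x₁ < … < x_d`: a formal bracket
`[[x_{i₁}, …, x_{iₙ}], x_{j₂}, …, x_{jₙ}]` whose inner entries are strictly ordered and whose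
outer entries are strictly ordered. -/
structure BasicCommutator₃ (n d : ℕ) where
  inner : Fin n ↪o Fin d
  outer : Fin (n - 1) ↪o Fin d

/-- The number `l_d^n(3)` of basic commutators of weight `3` on `d` generators. -/
noncomputable def basicCommutatorNumber₃ (n d : ℕ) : ℕ := Nat.card (BasicCommutator₃ n d)

theorem card_orderEmb (k d : ℕ) : Nat.card (Fin k ↪o Fin d) = d.choose k := by
  have e : (Fin k ↪o Fin d) ≃ Finset.powersetCard k (Finset.univ : Finset (Fin d)) :=
    { toFun := fun f => ⟨Finset.univ.map f.toEmbedding, by simp [Finset.mem_powersetCard]⟩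
      invFun := fun s => s.1.orderEmbOfFin (Finset.mem_powersetCard.1 s.2).2
      left_inv := fun f => by
        symm
        exact Finset.orderEmbOfFin_unique' _ (fun x => by simp)
      right_inv := fun s => by
        apply Subtype.ext
        apply Finset.coe_injective
        simp }
  rw [Nat.card_congr e]
  simp

/-- `l_d^n(3) = (d choose n) * (d choose n-1)`. -/
theorem basicCommutatorNumber₃_eq (n d : ℕ) :
    basicCommutatorNumber₃ n d = d.choose n * d.choose (n - 1) := by
  have e : BasicCommutator₃ n d ≃ (Fin n ↪o Fin d) × (Fin (n - 1) ↪o Fin d) :=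
    ⟨fun c => (c.1, c.2), fun p => ⟨p.1, p.2⟩, fun _ => rfl, fun _ => rfl⟩
  rw [basicCommutatorNumber₃, Nat.card_congr e, Nat.card_prod, card_orderEmb, card_orderEmb]

end NLieAlgebra

/-! A weight-3 bracket `[[x₁,…,xₙ],y₂,…,yₙ]` in `L` vanishes as soon as one entry lies in `Z₂`. For
an inner entry, the inner bracket is central. For an outer entry, the Filippov identity moves it
inside every inner bracket, and each of these becomes central. If `a₁,…,a_d` span `L` modulo `Z₂`,
then by multilinearity and alternation the basic commutators in the `aᵢ` span `γ₃(L)`. The same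
argument with the chain `γ₂, γ₃, γ₄` in place of `Z₂, Z₁, 0` shows that the basic commutators in the
free generators span `γ₃(F)` modulo `γ₄(F)`; `lowerCentral_three_le_span_eval` covers both cases.

For the sharper bound, a linear map from `γ₃(F)/γ₄(F)` whose range contains `γ₃(L)` is needed. The
homomorphism `F → L` sending `xᵢ` to `aᵢ` need not kill `γ₄(F)`, so `L` is replaced by `L ⊗
𝔽[s]/(s³)` with bracket multiplied by `s`. There brackets of weight `k` start in degree `k - 1`, so
`γ₄` vanishes in degree 2, and the coefficient of `s²` reads off the weight-3 part (`weightThree`).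
-/

namespace NLieAlgebra

/-! ### Multilinear and alternating maps on spanning sets -/

section Spanning

variable {𝔽 : Type u} [Field 𝔽] {M : Type v} [AddCommGroup M] [Module 𝔽 M]

/-- Slots are freed from `T` one at a time: with the others fixed, the values of one slot that land
in `S` form a submodule. -/
theorem _root_.MultilinearMap.map_mem_of_forall_mem {ι : Type*} [Fintype ι] [DecidableEq ι]
    {P : Type*} [AddCommGroup P] [Module 𝔽 P] (f : MultilinearMap 𝔽 (fun _ : ι => M) P)
    {T : Set M} (hT : Submodule.span 𝔽 T = ⊤) (S : Submodule 𝔽 P)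
    (h : ∀ v : ι → M, (∀ i, v i ∈ T) → f v ∈ S) (v : ι → M) : f v ∈ S := by
  suffices H : ∀ s : Finset ι, ∀ v : ι → M, (∀ i, i ∉ s → v i ∈ T) → f v ∈ S from
    H Finset.univ v (fun i hi => absurd (Finset.mem_univ i) hi)
  intro s
  induction s using Finset.induction_on with
  | empty => exact fun v hv => h v fun i => hv i (Finset.notMem_empty i)
  | insert i s _ ih =>
    intro v hv
    have key : Submodule.span 𝔽 T ≤ S.comap (f.toLinearMap v i) := by
      rw [Submodule.span_le]
      intro t ht
      refine ih _ fun j hj => ?_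
      by_cases hji : j = i
      · subst hji; simpa using ht
      · simpa [hji] using hv j (by simp [hji, hj])
    have : v i ∈ S.comap (f.toLinearMap v i) := key (hT ▸ Submodule.mem_top)
    simpa using this

/-- Entries may be taken in `I` or among the `a j`. A repeated index gives zero, and distinct
indices can be sorted at the cost of a sign. -/
theorem _root_.AlternatingMap.map_mem_span_orderEmb {k d : ℕ} {P : Type*} [AddCommGroup P]
    [Module 𝔽 P] (f : M [⋀^Fin k]→ₗ[𝔽] P) (a : Fin d → M) {I : Submodule 𝔽 M}
    (ha : Submodule.span 𝔽 (Set.range a) ⊔ I = ⊤) (S : Submodule 𝔽 P)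
    (hI : ∀ v i, v i ∈ I → f v ∈ S) (hS : ∀ e : Fin k ↪o Fin d, f (a ∘ e) ∈ S)
    (v : Fin k → M) : f v ∈ S := by
  have hT : Submodule.span 𝔽 (Set.range a ∪ (I : Set M)) = ⊤ := by
    rw [Submodule.span_union, Submodule.span_eq, ha]
  refine f.toMultilinearMap.map_mem_of_forall_mem hT S (fun v hv => ?_) v
  by_cases hvI : ∃ i, v i ∈ I
  · obtain ⟨i, hi⟩ := hvI
    exact hI v i hi
  push Not at hvI
  have hv' : ∀ i, ∃ j, a j = v i := fun i => (hv i).resolve_right (hvI i)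
  choose w hw using hv'
  obtain rfl : a ∘ w = v := funext hw
  by_cases hinj : Function.Injective w
  · have hmono : StrictMono (w ∘ Tuple.sort w) :=
      (Tuple.monotone_sort w).strictMono_of_injective
        (hinj.comp (Tuple.sort w).injective)
    have := hS (OrderEmbedding.ofStrictMono _ hmono)
    have h2 := f.map_perm (a ∘ w) (Tuple.sort w)
    change f (a ∘ w ∘ Tuple.sort w) ∈ S at this
    rw [← Function.comp_assoc, h2] at this
    rcases Int.units_eq_one_or (Equiv.Perm.sign (Tuple.sort w)) with hs | hs
    · simpa [hs] using this
    · simpa [hs] using this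
  · rw [Function.Injective] at hinj
    push Not at hinj
    obtain ⟨i, j, hij, hne⟩ := hinj
    have : f (a ∘ w) = 0 := f.map_eq_zero_of_eq _ (by simp [hij]) hne
    change f (a ∘ w) ∈ S
    rw [this]
    exact S.zero_mem

end Spanning

/-! ### Central chains and weight-3 brackets -/

section Commutators

variable {n : ℕ} [NeZero n] {𝔽 : Type u} [Field 𝔽] {M : Type v} [AddCommGroup M] [Module 𝔽 M]
  [NLieAlgebra n 𝔽 M]

/-- `IdealBracketLE I J` says that `[I, M, …, M] ⊆ J`. -/
def IdealBracketLE (n : ℕ) [NeZero n] {𝔽 : Type u} [Field 𝔽] {M : Type v} [AddCommGroup M]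
    [Module 𝔽 M] [NLieAlgebra n 𝔽 M] (I J : Submodule 𝔽 M) : Prop :=
  ∀ z ∈ I, ∀ y : Fin n → M, bracket (n := n) (𝔽 := 𝔽) (Function.update y 0 z) ∈ J

/-- A transposition brings slot `i` to slot `0` and only changes the sign. -/
theorem IdealBracketLE.bracket_mem {I J : Submodule 𝔽 M} (h : IdealBracketLE n I J)
    (x : Fin n → M) (i : Fin n) (hi : x i ∈ I) : bracket (n := n) (𝔽 := 𝔽) x ∈ J := by
  have h1 := h (x i) hi (x ∘ Equiv.swap 0 i)
  have h2 : Function.update (x ∘ Equiv.swap 0 i) 0 (x i) = x ∘ Equiv.swap 0 i := by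
    rw [Function.update_eq_self_iff]; simp
  rw [h2, AlternatingMap.map_perm] at h1
  rcases Int.units_eq_one_or (Equiv.Perm.sign (Equiv.swap 0 i)) with hs | hs
  · simpa [hs] using h1
  · simpa [hs] using h1

theorem IdealBracketLE.inner_mem {I J N : Submodule 𝔽 M} (hIJ : IdealBracketLE n I J)
    (hJN : IdealBracketLE n J N) (x y : Fin n → M) (i : Fin n) (hi : x i ∈ I) :
    bracket (n := n) (𝔽 := 𝔽) (Function.update y 0 (bracket (n := n) (𝔽 := 𝔽) x)) ∈ N :=
  hJN _ (hIJ.bracket_mem x i hi) y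

/-- After the Filippov identity, `y j` sits in the inner bracket of every summand. Slot `0` is
excluded because the update overwrites `y 0`. -/
theorem IdealBracketLE.outer_mem {I J N : Submodule 𝔽 M} (hIJ : IdealBracketLE n I J)
    (hJN : IdealBracketLE n J N) (x y : Fin n → M) (j : Fin n) (hj0 : j ≠ 0) (hj : y j ∈ I) :
    bracket (n := n) (𝔽 := 𝔽) (Function.update y 0 (bracket (n := n) (𝔽 := 𝔽) x)) ∈ N := by
  rw [filippov]
  refine Submodule.sum_mem _ fun i _ => hJN.bracket_mem _ i ?_
  rw [Function.update_self]
  exact hIJ.bracket_mem _ j (by rwa [Function.update_of_ne hj0])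

theorem idealBracketLE_upperCentral (i : ℕ) :
    IdealBracketLE n (upperCentral n 𝔽 M (i + 1)) (upperCentral n 𝔽 M i) :=
  fun _ hz y => hz y

theorem idealBracketLE_lowerCentral (i : ℕ) :
    IdealBracketLE n (lowerCentral n 𝔽 M (i + 1)) (lowerCentral n 𝔽 M (i + 2)) :=
  fun z hz y => Submodule.subset_span ⟨z, hz, y, rfl⟩

theorem bracket_mem_lowerCentral_two (x : Fin n → M) :
    bracket (n := n) (𝔽 := 𝔽) x ∈ lowerCentral n 𝔽 M 2 :=
  (idealBracketLE_lowerCentral 0).bracket_mem x 0 (Submodule.mem_top (x := x 0))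

theorem lowerCentral_add_two_le {i : ℕ} {N : Submodule 𝔽 M}
    (h : IdealBracketLE n (lowerCentral n 𝔽 M (i + 1)) N) :
    lowerCentral n 𝔽 M (i + 2) ≤ N := by
  refine Submodule.span_le.2 ?_
  rintro _ ⟨a, ha, y, rfl⟩
  exact h a ha y

theorem lowerCentral_three_le_two : lowerCentral n 𝔽 M 3 ≤ lowerCentral n 𝔽 M 2 :=
  lowerCentral_add_two_le fun _ _ _ => bracket_mem_lowerCentral_two _

theorem lowerCentral_three_le {N : Submodule 𝔽 M}
    (h : ∀ x y : Fin n → M, bracket (n := n) (𝔽 := 𝔽)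
      (Function.update y 0 (bracket (n := n) (𝔽 := 𝔽) x)) ∈ N) :
    lowerCentral n 𝔽 M 3 ≤ N := by
  refine lowerCentral_add_two_le fun z hz y => ?_
  -- For fixed `y`, the `z` with `[z, y₂, …, yₙ] ∈ N` form a submodule, so brackets suffice as `z`.
  have : lowerCentral n 𝔽 M 2 ≤
      N.comap ((bracket (n := n) (𝔽 := 𝔽)).toMultilinearMap.toLinearMap y 0) :=
    lowerCentral_add_two_le fun a _ w => h (Function.update w 0 a) y
  exact this hz

end Commutators

theorem update_zero_eq_vecCons {m : ℕ} [NeZero (m + 1)] {M : Type*} (y : Fin (m + 1) → M)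
    (z : M) :
    Function.update y 0 z = Matrix.vecCons z (Matrix.vecTail y) := by
  funext i
  refine Fin.cases ?_ (fun i => ?_) i
  · exact Function.update_self ..
  · exact Function.update_of_ne (Fin.succ_ne_zero i) ..

/-! ### Spanning by basic commutators of weight 3 -/

section BasicCommutators

variable {m : ℕ} [NeZero (m + 1)] {𝔽 : Type u} [Field 𝔽] {M : Type v} [AddCommGroup M]
  [Module 𝔽 M] [NLieAlgebra (m + 1) 𝔽 M]

/-- The value of a basic commutator of weight `3` when the generators are given the values `a`. -/
def BasicCommutator₃.eval (𝔽 : Type u) [Field 𝔽] {M : Type v} [AddCommGroup M]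
    [Module 𝔽 M] [NLieAlgebra (m + 1) 𝔽 M] {d : ℕ} (a : Fin d → M)
    (c : BasicCommutator₃ (m + 1) d) : M :=
  bracket (n := m + 1) (𝔽 := 𝔽)
    (Matrix.vecCons (bracket (n := m + 1) (𝔽 := 𝔽) (a ∘ c.inner)) (a ∘ c.outer))

/-- Modulo `N`, entries from `I` contribute nothing, so inner and outer entries can be reduced
independently to strictly ordered generators. -/
theorem lowerCentral_three_le_span_eval {d : ℕ} (a : Fin d → M) {I J N : Submodule 𝔽 M}
    (hIJ : IdealBracketLE (m + 1) I J) (hJN : IdealBracketLE (m + 1) J N)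
    (ha : Submodule.span 𝔽 (Set.range a) ⊔ I = ⊤) :
    lowerCentral (m + 1) 𝔽 M 3 ≤
      Submodule.span 𝔽 (Set.range (BasicCommutator₃.eval (m := m) 𝔽 a)) ⊔ N := by
  refine lowerCentral_three_le fun x y => ?_
  rw [update_zero_eq_vecCons]
  have hN : N ≤ Submodule.span 𝔽 (Set.range (BasicCommutator₃.eval (m := m) 𝔽 a)) ⊔ N :=
    le_sup_right
  have h_cons : ∀ (z : M) (v : Fin m → M), (Matrix.vecCons z v : Fin (m + 1) → M) =
      Function.update (Matrix.vecCons z v) 0 z := fun z v => by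
    rw [update_zero_eq_vecCons]; rfl
  -- Reduction of the outer entries, with the inner bracket fixed.
  refine AlternatingMap.map_mem_span_orderEmb
    ((bracket (n := m + 1) (𝔽 := 𝔽)).curryLeft (bracket (n := m + 1) (𝔽 := 𝔽) x)) a ha _
    (fun v i hi => hN ?_) (fun e => ?_) (Matrix.vecTail y)
  · rw [AlternatingMap.curryLeft_apply_apply, h_cons]
    exact hIJ.outer_mem hJN x _ i.succ (Fin.succ_ne_zero i) hi
  · have h := AlternatingMap.map_mem_span_orderEmb
      (((bracket (n := m + 1) (𝔽 := 𝔽)).toMultilinearMap.toLinearMap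
        (Matrix.vecCons 0 (a ∘ e)) 0).compAlternatingMap (bracket (n := m + 1) (𝔽 := 𝔽))) a ha
      (Submodule.span 𝔽 (Set.range (BasicCommutator₃.eval (m := m) 𝔽 a)) ⊔ N)
      (fun v i hi => hN (hIJ.inner_mem hJN v _ i hi)) (fun e' => ?_) x
    · change bracket (n := m + 1) (𝔽 := 𝔽) (Function.update _ 0 _) ∈ _ at h
      rw [update_zero_eq_vecCons] at h
      exact h
    · refine Submodule.mem_sup_left (Submodule.subset_span ⟨⟨e', e⟩, ?_⟩)
      change _ = bracket (n := m + 1) (𝔽 := 𝔽) (Function.update _ 0 _)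
      rw [update_zero_eq_vecCons]
      rfl

theorem BasicCommutator₃.eval_mem {d : ℕ} (a : Fin d → M) (c : BasicCommutator₃ (m + 1) d) :
    c.eval 𝔽 a ∈ lowerCentral (m + 1) 𝔽 M 3 :=
  (idealBracketLE_lowerCentral 1).bracket_mem _ 0 (bracket_mem_lowerCentral_two _)

instance (n d : ℕ) : Finite (BasicCommutator₃ n d) :=
  Finite.of_injective (fun c => (c.inner, c.outer)) fun ⟨_, _⟩ ⟨_, _⟩ h => by simpa using h

/-- Basic commutators lie in `γ₃` themselves, so their classes span the quotient and their number
bounds its rank. -/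
theorem rank_lowerCentral_three_quotient_le {d : ℕ} (a : Fin d → M) {N : Submodule 𝔽 M}
    (h : lowerCentral (m + 1) 𝔽 M 3 ≤
      Submodule.span 𝔽 (Set.range (BasicCommutator₃.eval (m := m) 𝔽 a)) ⊔ N) :
    Module.rank 𝔽 (lowerCentral (m + 1) 𝔽 M 3 ⧸ N.submoduleOf (lowerCentral (m + 1) 𝔽 M 3)) ≤
      basicCommutatorNumber₃ (m + 1) d := by
  set γ := lowerCentral (m + 1) 𝔽 M 3
  have hspan : Submodule.span 𝔽 (Set.range fun c : BasicCommutator₃ (m + 1) d =>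
      (N.submoduleOf γ).mkQ ⟨c.eval 𝔽 a, c.eval_mem a⟩) = ⊤ := by
    rw [eq_top_iff]
    rintro q -
    obtain ⟨⟨x, hx⟩, rfl⟩ := Submodule.mkQ_surjective _ q
    obtain ⟨s, hs, t, ht, rfl⟩ := Submodule.mem_sup.1 (h hx)
    have hs' : Submodule.span 𝔽 (Set.range (BasicCommutator₃.eval (m := m) 𝔽 a)) ≤ γ := by
      rw [Submodule.span_le]
      rintro _ ⟨c, rfl⟩
      exact c.eval_mem a
    have e : (N.submoduleOf γ).mkQ ⟨s + t, hx⟩ = (N.submoduleOf γ).mkQ ⟨s, hs' hs⟩ := by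
      rw [Submodule.mkQ_apply, Submodule.mkQ_apply, Submodule.Quotient.eq]
      simpa [Submodule.submoduleOf] using ht
    rw [e]
    clear e ht hx
    -- Transfers the span from `M` to the quotient of `γ`; the membership proof is quantified so
    -- that the induction goes through.
    have key : ∀ s (hs : s ∈ Submodule.span 𝔽 (Set.range (BasicCommutator₃.eval (m := m) 𝔽 a)))
        (hg : s ∈ γ), (N.submoduleOf γ).mkQ ⟨s, hg⟩ ∈ Submodule.span 𝔽
          (Set.range fun c : BasicCommutator₃ (m + 1) d =>
            (N.submoduleOf γ).mkQ ⟨c.eval 𝔽 a, c.eval_mem a⟩) := by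
      intro s hs
      induction hs using Submodule.span_induction with
      | mem x hx =>
        obtain ⟨c, rfl⟩ := hx
        exact fun _ => Submodule.subset_span ⟨c, rfl⟩
      | zero => exact fun hg => (map_zero (N.submoduleOf γ).mkQ).symm ▸ Submodule.zero_mem _
      | add x y hx hy ihx ihy =>
        exact fun _ => Submodule.add_mem _ (ihx (hs' hx)) (ihy (hs' hy))
      | smul r x hx ih => exact fun _ => Submodule.smul_mem _ r (ih (hs' hx))
    exact key s hs _
  have hle := rank_span_le (R := 𝔽) (Set.range fun c : BasicCommutator₃ (m + 1) d =>
      (N.submoduleOf γ).mkQ ⟨c.eval 𝔽 a, c.eval_mem a⟩)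
  rw [hspan, rank_top] at hle
  refine hle.trans ?_
  have h0 := Cardinal.mk_range_le_lift (f := fun c : BasicCommutator₃ (m + 1) d =>
      (N.submoduleOf γ).mkQ ⟨c.eval 𝔽 a, c.eval_mem a⟩)
  rw [← Nat.cast_card (α := BasicCommutator₃ (m + 1) d)] at h0
  simpa [basicCommutatorNumber₃] using h0

end BasicCommutators

/-! ### The truncated algebra, where weight becomes degree in `s` -/

section Truncation

variable (n : ℕ) [NeZero n] (𝔽 : Type u) [Field 𝔽] (L : Type v) [AddCommGroup L] [Module 𝔽 L]
  [NLieAlgebra n 𝔽 L]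

/-- The underlying space of the `n`-Lie algebra `L ⊗ 𝔽[s]/(s³)` with bracket multiplied by `s`:
a triple `(a, b, c)` stands for `a + b s + c s²`. -/
def Truncation (L : Type v) : Type v := L × L × L

instance : AddCommGroup (Truncation L) := inferInstanceAs (AddCommGroup (L × L × L))

instance : Module 𝔽 (Truncation L) := inferInstanceAs (Module 𝔽 (L × L × L))

namespace Truncation

/-- The coefficient of `1`. -/
def coeff₀ : Truncation L →ₗ[𝔽] L := LinearMap.fst 𝔽 L (L × L)

/-- The coefficient of `s`. -/
def coeff₁ : Truncation L →ₗ[𝔽] L := LinearMap.fst 𝔽 L L ∘ₗ LinearMap.snd 𝔽 L (L × L)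

/-- The coefficient of `s²`. -/
def coeff₂ : Truncation L →ₗ[𝔽] L := LinearMap.snd 𝔽 L L ∘ₗ LinearMap.snd 𝔽 L (L × L)

variable {𝔽 L} in
theorem ext' {x y : Truncation L} (h₀ : coeff₀ 𝔽 L x = coeff₀ 𝔽 L y)
    (h₁ : coeff₁ 𝔽 L x = coeff₁ 𝔽 L y) (h₂ : coeff₂ 𝔽 L x = coeff₂ 𝔽 L y) : x = y :=
  Prod.ext h₀ (Prod.ext h₁ h₂)

/-- The part of the bracket of degree `2`. -/
def bracket₂ : Truncation L [⋀^Fin n]→ₗ[𝔽] L where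
  toFun x := ∑ i, bracket (n := n) (𝔽 := 𝔽)
    (Function.update (fun j => coeff₀ 𝔽 L (x j)) i (coeff₁ 𝔽 L (x i)))
  map_update_add' := by
    intro inst x i a b
    obtain rfl : inst = instDecidableEqFin n := Subsingleton.elim _ _
    rw [← Finset.sum_add_distrib]
    refine Finset.sum_congr rfl fun j _ => ?_
    have h (c : Truncation L) : (fun k => coeff₀ 𝔽 L (Function.update x i c k)) =
        Function.update (fun k => coeff₀ 𝔽 L (x k)) i (coeff₀ 𝔽 L c) :=
      funext fun k => Function.apply_update (fun _ => coeff₀ 𝔽 L) x i c k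
    by_cases hji : j = i
    · subst hji
      simp [h]
    · simp only [h, Function.update_of_ne hji, Function.update_comm (Ne.symm hji), map_add,
        AlternatingMap.map_update_add]
  map_update_smul' := by
    intro inst x i r a
    obtain rfl : inst = instDecidableEqFin n := Subsingleton.elim _ _
    rw [Finset.smul_sum]
    refine Finset.sum_congr rfl fun j _ => ?_
    have h (c : Truncation L) : (fun k => coeff₀ 𝔽 L (Function.update x i c k)) =
        Function.update (fun k => coeff₀ 𝔽 L (x k)) i (coeff₀ 𝔽 L c) :=
      funext fun k => Function.apply_update (fun _ => coeff₀ 𝔽 L) x i c k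
    by_cases hji : j = i
    · subst hji
      simp [h]
    · simp only [h, Function.update_of_ne hji, Function.update_comm (Ne.symm hji), map_smul,
        AlternatingMap.map_update_smul]
  map_eq_zero_of_eq' := by
    intro x p q h hpq
    -- Every summand other than `p` and `q` keeps two equal entries; these two differ by a
    -- transposition and cancel.
    rw [← Finset.sum_subset (Finset.subset_univ {p, q}), Finset.sum_pair hpq]
    · rw [← AlternatingMap.map_swap_add (bracket (n := n) (𝔽 := 𝔽)) _ hpq, add_comm]
      congr 2
      funext k
      simp only [Function.comp_apply, Function.update_apply]
      rcases eq_or_ne k p with rfl | hkp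
      · simp [hpq, hpq.symm, h]
      rcases eq_or_ne k q with rfl | hkq
      · simp [h]
      rw [Equiv.swap_apply_of_ne_of_ne hkp hkq]
      simp [hkp, hkq]
    · intro i _ hi
      simp only [Finset.mem_insert, Finset.mem_singleton, not_or] at hi
      refine AlternatingMap.map_eq_zero_of_eq _ _ ?_ hpq
      rw [Function.update_of_ne (Ne.symm hi.1), Function.update_of_ne (Ne.symm hi.2), h]

/-- The bracket of the truncation: `[a + b s + c s², …] = [a, …] s + (∑ᵢ [a, …, bᵢ, …, a]) s²`. -/
def bracketMap : Truncation L [⋀^Fin n]→ₗ[𝔽] Truncation L :=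
  (LinearMap.inr 𝔽 L (L × L) ∘ₗ LinearMap.inl 𝔽 L L).compAlternatingMap
      ((bracket (n := n) (𝔽 := 𝔽)).compLinearMap (coeff₀ 𝔽 L)) +
    (LinearMap.inr 𝔽 L (L × L) ∘ₗ LinearMap.inr 𝔽 L L).compAlternatingMap (bracket₂ n 𝔽 L)

variable {n 𝔽 L}

theorem coeff₀_bracketMap (x : Fin n → Truncation L) :
    coeff₀ 𝔽 L (bracketMap n 𝔽 L x) = 0 := add_zero (0 : L)

theorem coeff₁_bracketMap (x : Fin n → Truncation L) :
    coeff₁ 𝔽 L (bracketMap n 𝔽 L x) =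
      bracket (n := n) (𝔽 := 𝔽) (fun i => coeff₀ 𝔽 L (x i)) := add_zero (_ : L)

theorem coeff₂_bracketMap (x : Fin n → Truncation L) :
    coeff₂ 𝔽 L (bracketMap n 𝔽 L x) = ∑ i, bracket (n := n) (𝔽 := 𝔽)
      (Function.update (fun j => coeff₀ 𝔽 L (x j)) i (coeff₁ 𝔽 L (x i))) := zero_add (_ : L)

theorem coeff₁_bracketMap_update (x : Fin n → Truncation L) (i : Fin n) {z : Truncation L}
    (hz : coeff₀ 𝔽 L z = 0) : coeff₁ 𝔽 L (bracketMap n 𝔽 L (Function.update x i z)) = 0 := by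
  rw [coeff₁_bracketMap]
  exact AlternatingMap.map_coord_zero _ i (by simp [hz])

/-- All summands except the `i`-th retain the zero constant term of `z` as an entry. -/
theorem coeff₂_bracketMap_update (x : Fin n → Truncation L) (i : Fin n) {z : Truncation L}
    (hz : coeff₀ 𝔽 L z = 0) : coeff₂ 𝔽 L (bracketMap n 𝔽 L (Function.update x i z)) =
      bracket (n := n) (𝔽 := 𝔽)
        (Function.update (fun j => coeff₀ 𝔽 L (x j)) i (coeff₁ 𝔽 L z)) := by
  rw [coeff₂_bracketMap, Finset.sum_eq_single i]
  · congr 1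
    funext k
    rcases eq_or_ne k i with rfl | hk
    · simp
    · simp [hk]
  · intro j _ hj
    exact AlternatingMap.map_coord_zero _ i (by simp [Ne.symm hj, hz])
  · simp

instance : NLieAlgebra n 𝔽 (Truncation L) where
  bracket := bracketMap n 𝔽 L
  filippov x y := by
    -- Double brackets live in degree 2 only, where the identity is that of `L` applied to the
    -- constant terms.
    have h0 (w : Fin n → Truncation L) := coeff₀_bracketMap (𝔽 := 𝔽) w
    refine ext' (𝔽 := 𝔽) ?_ ?_ ?_
    · simp only [map_sum, h0, Finset.sum_const_zero]
    · simp only [map_sum, coeff₁_bracketMap_update _ _ (h0 _), Finset.sum_const_zero]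
    · simp only [map_sum, coeff₂_bracketMap_update _ _ (h0 _), coeff₁_bracketMap]
      have h (c : Truncation L) : (fun k => coeff₀ 𝔽 L (Function.update y 0 c k)) =
          Function.update (fun k => coeff₀ 𝔽 L (y k)) 0 (coeff₀ 𝔽 L c) :=
        funext fun k => Function.apply_update (fun _ => coeff₀ 𝔽 L) y 0 c k
      simp only [h]
      exact filippov _ _

theorem bracket_eq (x : Fin n → Truncation L) :
    bracket (n := n) (𝔽 := 𝔽) x = bracketMap n 𝔽 L x := rfl

variable (n 𝔽 L)

theorem lowerCentral_two_le : lowerCentral n 𝔽 (Truncation L) 2 ≤ LinearMap.ker (coeff₀ 𝔽 L) :=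
  lowerCentral_add_two_le fun _ _ _ => coeff₀_bracketMap _

theorem lowerCentral_three_le :
    lowerCentral n 𝔽 (Truncation L) 3 ≤ LinearMap.ker (coeff₁ 𝔽 L) :=
  lowerCentral_add_two_le fun _ hz _ =>
    coeff₁_bracketMap_update _ _ (lowerCentral_two_le n 𝔽 L hz)

/-- An element of `γ₃` has neither constant nor linear term, so bracketing it once more leaves
nothing in degree 2. -/
theorem lowerCentral_four_le :
    lowerCentral n 𝔽 (Truncation L) 4 ≤ LinearMap.ker (coeff₂ 𝔽 L) := by
  refine lowerCentral_add_two_le fun z hz y => ?_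
  rw [LinearMap.mem_ker, bracket_eq, coeff₂_bracketMap_update _ _
    (lowerCentral_two_le n 𝔽 L (lowerCentral_three_le_two hz)),
    show coeff₁ 𝔽 L z = 0 from lowerCentral_three_le n 𝔽 L hz]
  exact AlternatingMap.map_update_zero _ _ _

end Truncation

end Truncation

/-! ### The universal property of the free algebra -/

section Lift

variable {n : ℕ} [NeZero n] {𝔽 : Type u} [Field 𝔽] {X : Type*} {M : Type v} [AddCommGroup M]
  [Module 𝔽 M] [NLieAlgebra n 𝔽 M]

/-- The value of a formal expression in an `n`-Lie algebra. -/
def FreePre.eval (f : X → M) : FreePre n 𝔽 X → M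
  | .of x => f x
  | .zero => 0
  | .add a b => a.eval f + b.eval f
  | .smul r a => r • a.eval f
  | .bracket x => NLieAlgebra.bracket (n := n) (𝔽 := 𝔽) fun i => (x i).eval f

theorem FreePre.eval_sum (f : X → M) {k : ℕ} (x : Fin k → FreePre n 𝔽 X) :
    (FreePre.sum x).eval f = ∑ i, (x i).eval f := by
  induction k with
  | zero => rw [Fin.sum_univ_zero]; rfl
  | succ k ih => rw [Fin.sum_univ_succ, ← ih]; rfl

theorem FreePre.eval_bracket_update (f : X → M) (x : Fin n → FreePre n 𝔽 X) (i : Fin n)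
    (a : FreePre n 𝔽 X) : (FreePre.bracket (Function.update x i a)).eval f =
      NLieAlgebra.bracket (n := n) (𝔽 := 𝔽)
        (Function.update (fun j => (x j).eval f) i (a.eval f)) := by
  rw [FreePre.eval]
  congr 1
  exact funext fun j => Function.apply_update (fun _ => FreePre.eval f) x i a j

theorem FreePre.Rel.eval_eq (f : X → M) {a b : FreePre n 𝔽 X} (h : FreePre.Rel n 𝔽 X a b) :
    a.eval f = b.eval f := by
  induction h with
  | refl => rfl
  | symm _ ih => exact ih.symm
  | trans _ _ ih ih' => exact ih.trans ih'
  | add_congr _ _ ih ih' => simp only [FreePre.eval, ih, ih']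
  | smul_congr r _ ih => simp only [FreePre.eval, ih]
  | bracket_congr _ ih => simp only [FreePre.eval, ih]
  | add_assoc => exact _root_.add_assoc ..
  | add_comm => exact _root_.add_comm ..
  | zero_add => exact _root_.zero_add ..
  | smul_add => exact _root_.smul_add ..
  | add_smul => exact _root_.add_smul ..
  | mul_smul => exact SemigroupAction.mul_smul ..
  | one_smul => exact _root_.one_smul ..
  | zero_smul => exact _root_.zero_smul ..
  | bracket_add x i a b =>
    rw [FreePre.eval_bracket_update, FreePre.eval, FreePre.eval, FreePre.eval_bracket_update,
      FreePre.eval_bracket_update, AlternatingMap.map_update_add]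
  | bracket_smul x i r a =>
    rw [FreePre.eval_bracket_update, FreePre.eval, FreePre.eval, FreePre.eval_bracket_update,
      AlternatingMap.map_update_smul]
  | bracket_alt x i j hij h => exact AlternatingMap.map_eq_zero_of_eq _ _ (by rw [h]) hij
  | filippov x y =>
    simp only [FreePre.eval_sum, FreePre.eval_bracket_update]
    exact NLieAlgebra.filippov _ _

namespace Free

/-- The homomorphism from the free `n`-Lie algebra that extends a map on the generators. -/
def lift (f : X → M) : Free n 𝔽 X →ₗ[𝔽] M where
  toFun := Quotient.lift (FreePre.eval f) fun _ _ h => FreePre.Rel.eval_eq f h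
  map_add' a b := by
    obtain ⟨a, rfl⟩ := mk_surjective a
    obtain ⟨b, rfl⟩ := mk_surjective b
    rfl
  map_smul' r a := by
    obtain ⟨a, rfl⟩ := mk_surjective a
    rfl

theorem bracket_mk (x : Fin n → FreePre n 𝔽 X) :
    NLieAlgebra.bracket (n := n) (𝔽 := 𝔽) (fun i => mk (x i)) = mk (FreePre.bracket x) :=
  (mk_bracket x).symm

theorem lift_bracket (f : X → M) (x : Fin n → Free n 𝔽 X) :
    lift f (NLieAlgebra.bracket (n := n) (𝔽 := 𝔽) x) =
      NLieAlgebra.bracket (n := n) (𝔽 := 𝔽) fun i => lift f (x i) := by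
  obtain ⟨x, rfl⟩ := exists_rep x
  rw [bracket_mk]
  rfl

theorem span_of_sup_lowerCentral_two :
    Submodule.span 𝔽 (Set.range (of n 𝔽 (X := X))) ⊔ lowerCentral n 𝔽 (Free n 𝔽 X) 2 = ⊤ := by
  rw [eq_top_iff]
  rintro a -
  obtain ⟨a, rfl⟩ := mk_surjective a
  induction a with
  | of x => exact Submodule.mem_sup_left (Submodule.subset_span ⟨x, rfl⟩)
  | zero => exact Submodule.zero_mem _
  | add a b iha ihb => exact Submodule.add_mem _ iha ihb
  | smul r a ih => exact Submodule.smul_mem _ r ih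
  | bracket x =>
    rw [← bracket_mk]
    exact Submodule.mem_sup_right (bracket_mem_lowerCentral_two _)

end Free

end Lift

/-! ### Comparison of the free algebra with `L` -/

section Homomorphism

theorem map_lowerCentral_le {n : ℕ} [NeZero n] {𝔽 : Type u} [Field 𝔽] {M : Type*}
    [AddCommGroup M] [Module 𝔽 M] [NLieAlgebra n 𝔽 M] {N : Type*} [AddCommGroup N] [Module 𝔽 N]
    [NLieAlgebra n 𝔽 N] (φ : M →ₗ[𝔽] N)
    (hφ : ∀ x : Fin n → M, φ (bracket (n := n) (𝔽 := 𝔽) x) =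
      bracket (n := n) (𝔽 := 𝔽) fun i => φ (x i)) (i : ℕ) :
    lowerCentral n 𝔽 M (i + 1) ≤ (lowerCentral n 𝔽 N (i + 1)).comap φ := by
  induction i with
  | zero => exact fun _ _ => Submodule.mem_top
  | succ i ih =>
    refine lowerCentral_add_two_le fun z hz y => ?_
    rw [Submodule.mem_comap, hφ]
    exact (idealBracketLE_lowerCentral i).bracket_mem _ 0
      (by rw [Function.update_self]; exact ih hz)

variable {m : ℕ} [NeZero (m + 1)] {𝔽 : Type u} [Field 𝔽] {L : Type v} [AddCommGroup L]
  [Module 𝔽 L] [NLieAlgebra (m + 1) 𝔽 L]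

/-- The linear map from the free algebra that takes a bracket of weight `3` in the generators to
its value in `L` and vanishes on all other weights. -/
def weightThree (m : ℕ) [NeZero (m + 1)] (𝔽 : Type u) [Field 𝔽] {L : Type v} [AddCommGroup L]
    [Module 𝔽 L] [NLieAlgebra (m + 1) 𝔽 L] {X : Type*} (a : X → L) :
    Free (m + 1) 𝔽 X →ₗ[𝔽] L :=
  Truncation.coeff₂ 𝔽 L ∘ₗ Free.lift fun x => ((a x, 0, 0) : Truncation L)

/-- The lift sends `γ₄(F)` into `γ₄` of the truncation, which has no `s²` term. This lets
`weightThree` descend to `γ₃(F)/γ₄(F)`. -/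
theorem weightThree_eq_zero {X : Type*} (a : X → L) :
    lowerCentral (m + 1) 𝔽 (Free (m + 1) 𝔽 X) 4 ≤ LinearMap.ker (weightThree m 𝔽 a) :=
  fun _ hz => Truncation.lowerCentral_four_le (m + 1) 𝔽 L
    (map_lowerCentral_le _ (Free.lift_bracket _) 3 hz)

/-- Each of the two brackets contributes one factor `s`, and the generators are sent to constants
`aᵢ`, so the `s²` coefficient is the value in `L`. -/
theorem weightThree_eval {d : ℕ} (a : Fin d → L) (c : BasicCommutator₃ (m + 1) d) :
    weightThree m 𝔽 a (c.eval 𝔽 (Free.of (m + 1) 𝔽)) = c.eval 𝔽 a := by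
  set f : Fin d → Truncation L := fun x => (a x, 0, 0)
  have h1 : Free.lift f (c.eval 𝔽 (Free.of (m + 1) 𝔽)) = c.eval 𝔽 f := by
    rw [BasicCommutator₃.eval, Free.lift_bracket, BasicCommutator₃.eval]
    congr 1
    funext i
    refine Fin.cases ?_ (fun i => rfl) i
    exact Free.lift_bracket _ _
  change Truncation.coeff₂ 𝔽 L (Free.lift f _) = _
  have h2 : ∀ (z : Truncation L) (v : Fin m → Truncation L),
      Matrix.vecCons z v = Function.update (Matrix.vecCons 0 v) 0 z := fun z v => by
    rw [update_zero_eq_vecCons]; rfl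
  rw [h1, BasicCommutator₃.eval, Truncation.bracket_eq, Truncation.bracket_eq, h2,
    Truncation.coeff₂_bracketMap_update _ _ (Truncation.coeff₀_bracketMap _),
    Truncation.coeff₁_bracketMap, update_zero_eq_vecCons]
  rfl

theorem lift_rank_lowerCentral_three_le {d : ℕ} (a : Fin d → L)
    (ha : Submodule.span 𝔽 (Set.range a) ⊔ upperCentral (m + 1) 𝔽 L 2 = ⊤) :
    Cardinal.lift.{u} (Module.rank 𝔽 (lowerCentral (m + 1) 𝔽 L 3)) ≤
      Cardinal.lift.{v} (Module.rank 𝔽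
        (lowerCentral (m + 1) 𝔽 (Free (m + 1) 𝔽 (Fin d)) 3 ⧸
          (lowerCentral (m + 1) 𝔽 (Free (m + 1) 𝔽 (Fin d)) 4).submoduleOf
            (lowerCentral (m + 1) 𝔽 (Free (m + 1) 𝔽 (Fin d)) 3))) := by
  have hspan := lowerCentral_three_le_span_eval a (idealBracketLE_upperCentral 1)
    (idealBracketLE_upperCentral 0) ha
  -- Here `N = Z₀ = 0`, so the basic commutators span `γ₃(L)` exactly.
  rw [upperCentral, sup_bot_eq] at hspan
  let ψ := Submodule.liftQ
    ((lowerCentral (m + 1) 𝔽 (Free (m + 1) 𝔽 (Fin d)) 4).submoduleOf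
      (lowerCentral (m + 1) 𝔽 (Free (m + 1) 𝔽 (Fin d)) 3))
    (weightThree m 𝔽 a ∘ₗ Submodule.subtype _) fun z hz => weightThree_eq_zero a hz
  have hle : lowerCentral (m + 1) 𝔽 L 3 ≤ LinearMap.range ψ := by
    refine hspan.trans (Submodule.span_le.2 ?_)
    rintro _ ⟨c, rfl⟩
    exact ⟨Submodule.Quotient.mk ⟨_, c.eval_mem (Free.of (m + 1) 𝔽)⟩, weightThree_eval a c⟩
  exact (Cardinal.lift_le.2 (Submodule.rank_mono hle)).trans (lift_rank_range_le ψ)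

end Homomorphism

theorem exists_span_sup_eq_top {𝔽 : Type u} [Field 𝔽] {L : Type v} [AddCommGroup L] [Module 𝔽 L]
    (Z : Submodule 𝔽 L) {d : ℕ} (hd : Module.rank 𝔽 (L ⧸ Z) = d) :
    ∃ a : Fin d → L, Submodule.span 𝔽 (Set.range a) ⊔ Z = ⊤ := by
  have : Module.Finite 𝔽 (L ⧸ Z) :=
    Module.rank_lt_aleph0_iff.1 (hd ▸ Cardinal.natCast_lt_aleph0)
  let b := Module.finBasisOfFinrankEq 𝔽 (L ⧸ Z) (Module.finrank_eq_of_rank_eq hd)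
  choose a ha using fun i => Z.mkQ_surjective (b i)
  refine ⟨a, ?_⟩
  have h : (Submodule.span 𝔽 (Set.range a)).map Z.mkQ = ⊤ := by
    rw [Submodule.map_span, ← Set.range_comp, ← b.span_eq]
    congr 2
    exact funext ha
  have h2 := congrArg (Submodule.comap Z.mkQ) h
  rwa [Submodule.comap_map_mkQ, Submodule.comap_top, sup_comm] at h2

end NLieAlgebra

theorem mainTheorem12 (n : ℕ) [NeZero n] (hn : 2 ≤ n) (𝔽 : Type u) [Field 𝔽]
    (L : Type v) [AddCommGroup L] [Module 𝔽 L] [NLieAlgebra n 𝔽 L] (d : ℕ)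
    (hd : Module.rank 𝔽 (L ⧸ NLieAlgebra.upperCentral n 𝔽 L 2) = d) :
    Module.rank 𝔽 (NLieAlgebra.lowerCentral n 𝔽 L 3) ≤ NLieAlgebra.basicCommutatorNumber₃ n d ∧
    Cardinal.lift.{u} (Module.rank 𝔽 (NLieAlgebra.lowerCentral n 𝔽 L 3)) ≤
      Cardinal.lift.{v} (Module.rank 𝔽
        (NLieAlgebra.lowerCentral n 𝔽 (NLieAlgebra.Free n 𝔽 (Fin d)) 3 ⧸
          (NLieAlgebra.lowerCentral n 𝔽 (NLieAlgebra.Free n 𝔽 (Fin d)) 4).submoduleOf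
            (NLieAlgebra.lowerCentral n 𝔽 (NLieAlgebra.Free n 𝔽 (Fin d)) 3))) ∧
    Module.rank 𝔽
        (NLieAlgebra.lowerCentral n 𝔽 (NLieAlgebra.Free n 𝔽 (Fin d)) 3 ⧸
          (NLieAlgebra.lowerCentral n 𝔽 (NLieAlgebra.Free n 𝔽 (Fin d)) 4).submoduleOf
            (NLieAlgebra.lowerCentral n 𝔽 (NLieAlgebra.Free n 𝔽 (Fin d)) 3)) ≤
      NLieAlgebra.basicCommutatorNumber₃ n d := by
  -- With `n = m + 1`, the `n - 1` outer entries are indexed by `Fin m`.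
  obtain ⟨m, rfl⟩ := Nat.exists_eq_succ_of_ne_zero (NeZero.ne n)
  obtain ⟨a, ha⟩ := NLieAlgebra.exists_span_sup_eq_top _ hd
  have hL := NLieAlgebra.lift_rank_lowerCentral_three_le a ha
  have hF := NLieAlgebra.rank_lowerCentral_three_quotient_le (𝔽 := 𝔽) (NLieAlgebra.Free.of (m + 1) 𝔽)
    (NLieAlgebra.lowerCentral_three_le_span_eval (𝔽 := 𝔽) (NLieAlgebra.Free.of (m + 1) 𝔽)
      (NLieAlgebra.idealBracketLE_lowerCentral 1) (NLieAlgebra.idealBracketLE_lowerCentral 2)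
      (NLieAlgebra.Free.span_of_sup_lowerCentral_two (X := Fin d)))
  refine ⟨?_, hL, hF⟩
  -- The bound by `l_d^n(3)` is the composite of the other two, up to universe lifts.
  have h := hL.trans (Cardinal.lift_le.2 hF)
  rwa [Cardinal.lift_natCast, ← Cardinal.lift_natCast.{u, v}, Cardinal.lift_le] at h
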